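/- \textbf{Model.} Let $\beta,\gamma\in(0,1)$, $r>0$, $\delta\ge 0$, $0<c^-<c^+$ with $(1-\beta\gamma)c^+<c^-$, and let $\mu\ge 0$ be a threshold. An agent's state at time $t=0,1,2,\dots$ is $(l_t,x_t)\in\{1,2\}\times\mathbb{R}_{\ge 0}$. At time $t$ it chooses an action $\vec a_t=(a_t^+,a_t^-)\in\mathbb{R}_{\ge0}^2$ (improvement, gaming), which results in the level $l_{t+1}=2$ if $x_t+a_t^++a_t^-\ge\mu$ and $l_{t+1}=1$ otherwise, and in the attribute $x_{t+1}=\gamma(x_t+a_t^+)+\delta(l_{t+1}-1)$. The agent maximizes the discounted total utility $\sum_{t=0}^\infty\beta^t\big(r(l_{t+1}-1)-c^+a_t^+-c^-a_t^-\big)\in[-\infty,\infty)$ over all action sequences. A Markov strategy (a map from states to actions) is called \emph{the agent's optimal strategy}, and its action at time $t$ is denoted $\vec a_t^*$, if following it is optimal from every initial state and, at every state, among all first actions of optimal action sequences it selects one with the largest improvement action $a^+$ and, among those, the one with the largest gaming action $a^-$. \textbf{Theorem.} Given $\beta,\gamma,r,c^+,c^-$ as above, there exist $0\le\underline\mu\le\overline\mu$,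 independent of $\delta$ and $\mu$, such that for every $\delta\ge0$ and every $\mu\ge\frac{\delta}{1-\gamma}$ there exist $\underline x,\overline x\in[0,\mu]$ for which the agent's optimal strategy exists, is unique, and is the following, at either level and at every attribute $x_t\ge0$: \begin{enumerate} \item[(1)] if $\mu\in\big[\frac{\delta}{1-\gamma},\,\underline\mu+\frac{\delta}{1-\gamma}\big)$, then $\vec a_t^*=(\mu-x_t,0)$ if $x_t\in[\underline x,\mu)$, and $\vec a_t^*=(0,0)$ otherwise; \item[(2)] if $\mu\in\big[\underline\mu+\frac{\delta}{1-\gamma},\,\overline\mu+\frac{\delta}{1-\gamma}\big)$, then $\vec a_t^*=(0,\mu-x_t)$ if $x_t\in\big[\mu-\frac{r}{c^-},\overline x\big)$, $\vec a_t^*=(\mu-x_t,0)$ if $x_t\in[\overline x,\mu)$, and $\vec a_t^*=(0,0)$ otherwise; \item[(3)] if $\mu\in\big[\overline\mu+\frac{\delta}{1-\gamma},\,\infty\big)$, then $\vec a_t^*=(0,\mu-x_t)$ if $x_t\in[\underline x,\mu]$, and $\vec a_t^*=(0,0)$ otherwise. \end{enumerate} -/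

import Mathlib

open scoped ENNReal

namespace TwoLevel

/-- The data of the two-level model: discount factor `β`, retention factor `γ`, leg-up factor `δ`,
reward rate `r`, unit costs of improvement and of gaming, and the promotion threshold `μ`. -/
structure Model where
  β : ℝ
  γ : ℝ
  δ : ℝ
  r : ℝ
  cPlus : ℝ
  cMinus : ℝ
  μ : ℝ

/-- The two levels `l = 1` and `l = 2`. -/
inductive Level where
  | one
  | two

/-- `l - 1` as a real number. -/
def Level.rank : Level → ℝ
  | .one => 0
  | .two => 1

/-- An effort vector: an improvement action and a gaming action. -/
@[ext]
structure Action where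
  improve : ℝ
  game : ℝ

namespace Model

noncomputable section

/-- The classifier output (`1` pass, `0` stay, `-1` fail) at each level, on a feature `z`. -/
def classifier (m : Model) : Level → ℝ → ℤ
  | .one, z => if m.μ ≤ z then 1 else 0
  | .two, z => if m.μ ≤ z then 0 else -1

/-- The level attained when the classifier of level `l` is applied to the feature `z`. -/
def nextLevel (m : Model) (l : Level) (z : ℝ) : Level :=
  match l with
  | .one => if m.classifier .one z = 1 then .two else .one
  | .two => if m.classifier .two z = -1 then .one else .two

/-- The per-stage reward collected on attaining the level `l`. -/
def reward (m : Model) (l : Level) : ℝ := m.r * l.rank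

/-- The per-stage cost of an action. -/
def cost (m : Model) (a : Action) : ℝ := m.cPlus * a.improve + m.cMinus * a.game

/-- One step of the dynamics on states `(level, attribute)`: the feature
`x + a⁺ + a⁻` determines the next level, the attribute `x + a⁺` depreciates by the factor `γ`
and receives the leg-up of the level attained. -/
def step (m : Model) (s : Level × ℝ) (a : Action) : Level × ℝ :=
  let l' := m.nextLevel s.1 (s.2 + a.improve + a.game)
  (l', m.γ * (s.2 + a.improve) + m.δ * l'.rank)

/-- The state at time `t` when the action sequence `a` is played from the state `s`. -/
def state (m : Model) (s : Level × ℝ) (a : ℕ → Action) : ℕ → Level × ℝ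
  | 0 => s
  | t + 1 => m.step (m.state s a t) (a t)

/-- The discounted total utility of the action sequence `a` played from `s`. Its value is `⊥`
(minus infinity) exactly when the discounted total cost is infinite. -/
def utility (m : Model) (s : Level × ℝ) (a : ℕ → Action) : EReal :=
  ((∑' t, m.β ^ t * m.reward (m.state s a (t + 1)).1 : ℝ) : EReal)
    - ((∑' t, ENNReal.ofReal (m.β ^ t * m.cost (a t)) : ℝ≥0∞) : EReal)

/-- Action sequences with nonnegative efforts. -/
def Feasible (a : ℕ → Action) : Prop := ∀ t, 0 ≤ (a t).improve ∧ 0 ≤ (a t).game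

/-- `a` maximizes the discounted total utility from the state `s` among all action sequences. -/
def IsOptimalPlan (m : Model) (s : Level × ℝ) (a : ℕ → Action) : Prop :=
  Feasible a ∧ ∀ b, Feasible b → m.utility s b ≤ m.utility s a

/-- The state at time `t` when the Markov strategy `σ` is followed from the state `s`. -/
def strategyState (m : Model) (σ : Level → ℝ → Action) (s : Level × ℝ) : ℕ → Level × ℝ
  | 0 => s
  | t + 1 => m.step (m.strategyState σ s t)
      (σ (m.strategyState σ s t).1 (m.strategyState σ s t).2)

/-- The action sequence that results from following the Markov strategy `σ` from `s`. -/
def strategyPlan (m : Model) (σ : Level → ℝ → Action) (s : Level × ℝ) : ℕ → Action :=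
  fun t => σ (m.strategyState σ s t).1 (m.strategyState σ s t).2

/-- `σ` is the agent's optimal (Markov) strategy: following it is optimal from every initial state,
and at every state ties between optimal actions are broken in favor of the largest improvement
action; ties that remain after that (between actions with the same improvement component) are
broken in favor of the larger gaming action, that is, of passing the test. -/
def IsOptimalStrategy (m : Model) (σ : Level → ℝ → Action) : Prop :=
  ∀ (l : Level) (x : ℝ), 0 ≤ x →
    m.IsOptimalPlan (l, x) (m.strategyPlan σ (l, x)) ∧
    ∀ a, m.IsOptimalPlan (l, x) a →
      (a 0).improve < (σ l x).improve ∨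
        ((a 0).improve = (σ l x).improve ∧ (a 0).game ≤ (σ l x).game)

end

end Model

end TwoLevel

/-!
The level attained at a time does not depend on the previous level, so the agent controls the
attribute alone.

**The value function.** Failing the test is never better than stopping all effort, improvement beyond
the threshold `μ` does not pay, and improving short of `μ` pays at most as much as improving up to
it or gaming at once. So it is enough to compare three options below `μ`: giving up (value `0`),
gaming up to `μ`, and improving up to `μ`. The value function `Model.value` is the limit of value
iteration for these options (`Model.bellman`). The Bellman operator preserves nonnegativity,
monotonicity, the Lipschitz constant `cPlus`, and convexity below `μ`
(`Model.regular_bellman`), so `Model.value` has these properties. They show that it dominates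
every action of the original problem (`Model.actionValue_le_value`).

**The strategy.** The excess of the value over that of improving up to `μ` is convex, nonnegative and
zero at `μ`, so it decreases strictly until it vanishes (`Model.excess_lt`). Hence the optimal
improvement actions, with ties broken as prescribed, are those of `Model.selector`, and the
attributes at which improving is optimal form an interval ending at `μ`. The verification principle
`Model.isOptimalStrategy_iff_of_bellman` turns this into a description of the optimal strategy.

**The thresholds.** At the break-even attribute `μ - r / cMinus` a single promotion just pays for
gaming. If improving is worthwhile there, then gaming is never better than improving
(`Model.excess_eq_zero_of_game_of_le`; here `(1 - β γ) cPlus < cMinus` enters through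
`Model.excess_le_of_game`), and perpetual improvement is optimal from `μ` on
(`Model.value_threshold_eq`). The value of perpetual improvement is explicit and depends on `δ` and
`μ` only through `μ - δ / (1 - γ)`; this yields `Model.muLow`. From `Model.muLow` on, the value is
`0` at the break-even attribute, so gaming is optimal between this attribute and the interval of
improvement. If moreover `μ - δ / (1 - γ)` is at least `r / (cMinus (1 - γ))`, the attribute falls
from `μ` to break-even or below within one period, so that improvement brings no future gain and
its interval shrinks to the point `μ`.
-/

namespace TwoLevel

namespace Model

noncomputable section

/-! ### Parameters -/

/-- The standing assumptions on the parameters. The last one says that the threshold is at least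
`δ / (1 - γ)`, the attribute that an agent of level two keeps without any effort. -/
structure Valid (m : Model) : Prop where
  β_pos : 0 < m.β
  β_lt_one : m.β < 1
  γ_pos : 0 < m.γ
  γ_lt_one : m.γ < 1
  r_pos : 0 < m.r
  cMinus_pos : 0 < m.cMinus
  cMinus_lt : m.cMinus < m.cPlus
  incentive : (1 - m.β * m.γ) * m.cPlus < m.cMinus
  δ_nonneg : 0 ≤ m.δ
  threshold : m.δ / (1 - m.γ) ≤ m.μ

lemma Valid.cPlus_pos {m : Model} (h : m.Valid) : 0 < m.cPlus := h.cMinus_pos.trans h.cMinus_lt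

/-! ### Total utilities and the verification principle -/

/-- The value of playing `a` at the state `s` when continuation attributes are worth `V`. -/
def actionValue (m : Model) (V : ℝ → ℝ) (s : Level × ℝ) (a : Action) : ℝ :=
  m.reward (m.step s a).1 - m.cost a + m.β * V (m.step s a).2

/-- The current level has no influence on the next one. -/
lemma nextLevel_eq (m : Model) (l : Level) (z : ℝ) :
    m.nextLevel l z = if m.μ ≤ z then .two else .one := by
  cases l <;> simp only [nextLevel, classifier] <;> split_ifs <;> simp_all

variable {m : Model}

lemma reward_nonneg (h : m.Valid) (l : Level) : 0 ≤ m.reward l := by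
  cases l <;> simp [reward, Level.rank, h.r_pos.le]

lemma reward_le (h : m.Valid) (l : Level) : m.reward l ≤ m.r := by
  cases l <;> simp [reward, Level.rank, h.r_pos.le]

lemma cost_nonneg (h : m.Valid) {a : Action} (ha : 0 ≤ a.improve ∧ 0 ≤ a.game) : 0 ≤ m.cost a :=
  add_nonneg (mul_nonneg h.cPlus_pos.le ha.1) (mul_nonneg h.cMinus_pos.le ha.2)

lemma step_nonneg (h : m.Valid) {s : Level × ℝ} (hs : 0 ≤ s.2)
    {a : Action} (ha : 0 ≤ a.improve) : 0 ≤ (m.step s a).2 := by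
  have hl : ∀ l : Level, 0 ≤ l.rank := fun l => by cases l <;> simp [Level.rank]
  exact add_nonneg (mul_nonneg h.γ_pos.le (add_nonneg hs ha)) (mul_nonneg h.δ_nonneg (hl _))

lemma state_nonneg (h : m.Valid) {s : Level × ℝ} (hs : 0 ≤ s.2)
    {a : ℕ → Action} (ha : Feasible a) : ∀ t, 0 ≤ (m.state s a t).2
  | 0 => hs
  | t + 1 => step_nonneg h (state_nonneg h hs ha t) (ha t).1

lemma state_strategyPlan (m : Model) (σ : Level → ℝ → Action) (s : Level × ℝ) :
    ∀ t, m.state s (m.strategyPlan σ s) t = m.strategyState σ s t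
  | 0 => rfl
  | t + 1 => by
    simp only [state, strategyState, state_strategyPlan m σ s t, strategyPlan]

/-- The utility accumulated before time `n`. -/
def partialUtility (m : Model) (s : Level × ℝ) (a : ℕ → Action) (n : ℕ) : ℝ :=
  ∑ t ∈ Finset.range n, m.β ^ t * (m.reward (m.state s a (t + 1)).1 - m.cost (a t))

lemma partialUtility_eq_sub (m : Model) (s : Level × ℝ) (a : ℕ → Action) (n : ℕ) :
    m.partialUtility s a n =
      ∑ t ∈ Finset.range n, m.β ^ t * m.reward (m.state s a (t + 1)).1 -
        ∑ t ∈ Finset.range n, m.β ^ t * m.cost (a t) := by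
  rw [partialUtility, ← Finset.sum_sub_distrib]
  exact Finset.sum_congr rfl fun t _ => mul_sub _ _ _

lemma summable_reward (h : m.Valid) (s : Level × ℝ) (a : ℕ → Action) :
    Summable fun t => m.β ^ t * m.reward (m.state s a (t + 1)).1 :=
  Summable.of_nonneg_of_le
    (fun t => mul_nonneg (pow_nonneg h.β_pos.le t) (reward_nonneg h _))
    (fun t => mul_le_mul_of_nonneg_left (reward_le h _) (pow_nonneg h.β_pos.le t))
    ((summable_geometric_of_lt_one h.β_pos.le h.β_lt_one).mul_right m.r)

lemma discounted_cost_nonneg (h : m.Valid) {a : ℕ → Action} (ha : Feasible a) (t : ℕ) :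
    0 ≤ m.β ^ t * m.cost (a t) :=
  mul_nonneg (pow_nonneg h.β_pos.le t) (cost_nonneg h (ha t))

lemma utility_eq_coe (h : m.Valid) (s : Level × ℝ) {a : ℕ → Action} (ha : Feasible a)
    (hs : Summable fun t => m.β ^ t * m.cost (a t)) :
    m.utility s a = ((∑' t, m.β ^ t * m.reward (m.state s a (t + 1)).1 -
      ∑' t, m.β ^ t * m.cost (a t) : ℝ) : EReal) := by
  rw [utility, ← ENNReal.ofReal_tsum_of_nonneg (discounted_cost_nonneg h ha) hs,
    EReal.coe_ennreal_ofReal, max_eq_left (tsum_nonneg (discounted_cost_nonneg h ha)),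
    EReal.coe_sub]

lemma utility_le_of_partialUtility_le (h : m.Valid) (s : Level × ℝ) {a : ℕ → Action}
    (ha : Feasible a) {K : ℝ} (hK : ∀ n, 1 ≤ n → m.partialUtility s a n ≤ K) :
    m.utility s a ≤ K := by
  by_cases hs : Summable fun t => m.β ^ t * m.cost (a t)
  · rw [utility_eq_coe h s ha hs, EReal.coe_le_coe_iff]
    have ht := (summable_reward h s a).hasSum.tendsto_sum_nat.sub hs.hasSum.tendsto_sum_nat
    refine le_of_tendsto ht (Filter.eventually_atTop.2 ⟨1, fun n hn => ?_⟩)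
    rw [← partialUtility_eq_sub]
    exact hK n hn
  · have htop : (∑' t, ENNReal.ofReal (m.β ^ t * m.cost (a t))) = ⊤ := by
      by_contra hne
      refine hs ?_
      have := ENNReal.summable_toReal hne
      refine this.congr fun t => ?_
      rw [ENNReal.toReal_ofReal (discounted_cost_nonneg h ha t)]
    rw [utility, htop, EReal.coe_ennreal_top, EReal.sub_top]
    exact bot_le

lemma utility_eq_of_tendsto (h : m.Valid) (s : Level × ℝ) {a : ℕ → Action} (ha : Feasible a)
    {K : ℝ} (hK : Filter.Tendsto (m.partialUtility s a) Filter.atTop (nhds K)) :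
    m.utility s a = K := by
  have hr := (summable_reward h s a).hasSum.tendsto_sum_nat
  have hc : Filter.Tendsto (fun n => ∑ t ∈ Finset.range n, m.β ^ t * m.cost (a t)) Filter.atTop
      (nhds (∑' t, m.β ^ t * m.reward (m.state s a (t + 1)).1 - K)) := by
    refine (hr.sub hK).congr fun n => ?_
    rw [partialUtility_eq_sub]; ring
  have hs := (hasSum_iff_tendsto_nat_of_nonneg (discounted_cost_nonneg h ha) _).2 hc
  rw [utility_eq_coe h s ha hs.summable, hs.tsum_eq, sub_sub_cancel]

/-- If no action is worth more than `V` promises, the utility accumulated up to a time together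
with the value of the state then reached is at most the value of the first action. -/
lemma partialUtility_add_le (h : m.Valid) {V : ℝ → ℝ}
    (hbell : ∀ l x a, 0 ≤ x → 0 ≤ a.improve ∧ 0 ≤ a.game → m.actionValue V (l, x) a ≤ V x)
    {s : Level × ℝ} (hs : 0 ≤ s.2) {a : ℕ → Action} (ha : Feasible a) (n : ℕ) :
    m.partialUtility s a (n + 1) + m.β ^ (n + 1) * V (m.state s a (n + 1)).2 ≤
      m.actionValue V s (a 0) := by
  induction n with
  | zero => simp [partialUtility, actionValue, state]
  | succ n ih =>
    refine le_trans ?_ ih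
    have hb := hbell (m.state s a (n + 1)).1 (m.state s a (n + 1)).2 (a (n + 1))
      (state_nonneg h hs ha (n + 1)) (ha (n + 1))
    have hb' := mul_le_mul_of_nonneg_left hb (pow_nonneg h.β_pos.le (n + 1))
    rw [actionValue] at hb'
    rw [partialUtility, Finset.sum_range_succ, ← partialUtility]
    have e : m.state s a (n + 1 + 1) = m.step (m.state s a (n + 1)) (a (n + 1)) := rfl
    rw [e, pow_succ m.β (n + 1)]
    linarith

lemma utility_le_actionValue (h : m.Valid) {V : ℝ → ℝ} (hV₀ : ∀ x, 0 ≤ V x)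
    (hbell : ∀ l x a, 0 ≤ x → 0 ≤ a.improve ∧ 0 ≤ a.game → m.actionValue V (l, x) a ≤ V x)
    {s : Level × ℝ} (hs : 0 ≤ s.2) {a : ℕ → Action} (ha : Feasible a) :
    m.utility s a ≤ (m.actionValue V s (a 0) : ℝ) := by
  refine utility_le_of_partialUtility_le h s ha fun n hn => ?_
  obtain ⟨k, rfl⟩ : ∃ k, n = k + 1 := ⟨n - 1, by omega⟩
  have h₁ := partialUtility_add_le h hbell hs ha k
  have h₂ := mul_nonneg (pow_nonneg h.β_pos.le (k + 1)) (hV₀ (m.state s a (k + 1)).2)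
  linarith

/-- A Markov strategy that attains a bounded `V` at every state earns `V`. -/
lemma utility_strategyPlan (h : m.Valid) {V : ℝ → ℝ} (hV₀ : ∀ x, 0 ≤ V x)
    {B : ℝ} (hVB : ∀ x, V x ≤ B) {σ : Level → ℝ → Action}
    (hσ : ∀ l x, 0 ≤ x → 0 ≤ (σ l x).improve ∧ 0 ≤ (σ l x).game)
    (hatt : ∀ l x, 0 ≤ x → m.actionValue V (l, x) (σ l x) = V x)
    (l : Level) {x : ℝ} (hx : 0 ≤ x) :
    Feasible (m.strategyPlan σ (l, x)) ∧
      m.utility (l, x) (m.strategyPlan σ (l, x)) = (V x : ℝ) := by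
  have hst : ∀ t, 0 ≤ (m.strategyState σ (l, x) t).2 := by
    intro t
    induction t with
    | zero => exact hx
    | succ t ih => exact step_nonneg h ih (hσ _ _ ih).1
  have hf : Feasible (m.strategyPlan σ (l, x)) := fun t => hσ _ _ (hst t)
  refine ⟨hf, utility_eq_of_tendsto h _ hf ?_⟩
  have htel : ∀ n, m.partialUtility (l, x) (m.strategyPlan σ (l, x)) n =
      V x - m.β ^ n * V (m.strategyState σ (l, x) n).2 := by
    intro n
    induction n with
    | zero => simp [partialUtility, strategyState]
    | succ n ih =>
      have hb := hatt (m.strategyState σ (l, x) n).1 (m.strategyState σ (l, x) n).2 (hst n)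
      rw [actionValue] at hb
      rw [partialUtility, Finset.sum_range_succ, ← partialUtility, ih, state_strategyPlan]
      have e : m.strategyState σ (l, x) (n + 1) = m.step (m.strategyState σ (l, x) n)
        (σ (m.strategyState σ (l, x) n).1 (m.strategyState σ (l, x) n).2) := rfl
      rw [e, pow_succ, strategyPlan]
      linear_combination m.β ^ n * hb
  have hlim : Filter.Tendsto (fun n => m.β ^ n * V (m.strategyState σ (l, x) n).2)
      Filter.atTop (nhds 0) := by
    have hp := (tendsto_pow_atTop_nhds_zero_of_lt_one h.β_pos.le h.β_lt_one).mul_const B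
    rw [zero_mul] at hp
    exact squeeze_zero (fun n => mul_nonneg (pow_nonneg h.β_pos.le n) (hV₀ _))
      (fun n => mul_le_mul_of_nonneg_left (hVB _) (pow_nonneg h.β_pos.le n)) hp
  have := tendsto_const_nhds (x := V x).sub hlim
  rw [sub_zero] at this
  exact this.congr fun n => (htel n).symm

/-- Verification principle: if `V` is bounded and dominates the value of every action, and `τ`
selects at every attribute the lexicographically largest action that attains `V`, then the agent's
optimal strategy is `τ`, and it is unique. -/
theorem isOptimalStrategy_iff_of_bellman (h : m.Valid) {V : ℝ → ℝ} (hV₀ : ∀ x, 0 ≤ V x)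
    {B : ℝ} (hVB : ∀ x, V x ≤ B) {τ : ℝ → Action}
    (hτ : ∀ x, 0 ≤ x → 0 ≤ (τ x).improve ∧ 0 ≤ (τ x).game)
    (hbell : ∀ l x a, 0 ≤ x → 0 ≤ a.improve ∧ 0 ≤ a.game → m.actionValue V (l, x) a ≤ V x)
    (hatt : ∀ l x, 0 ≤ x → m.actionValue V (l, x) (τ x) = V x)
    (hlex : ∀ l x a, 0 ≤ x → 0 ≤ a.improve ∧ 0 ≤ a.game → m.actionValue V (l, x) a = V x →
      a.improve < (τ x).improve ∨ (a.improve = (τ x).improve ∧ a.game ≤ (τ x).game))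
    (σ : Level → ℝ → Action) :
    m.IsOptimalStrategy σ ↔ ∀ l x, 0 ≤ x → σ l x = τ x := by
  have hbound : ∀ (l : Level) (x : ℝ), 0 ≤ x → ∀ a, Feasible a → m.utility (l, x) a ≤ (V x : ℝ) :=
    fun l x hx a ha => (utility_le_actionValue h hV₀ hbell hx ha).trans
      (EReal.coe_le_coe_iff.2 (hbell l x (a 0) hx (ha 0)))
  have hopt : ∀ σ : Level → ℝ → Action, (∀ l x, 0 ≤ x → σ l x = τ x) → ∀ l x, 0 ≤ x →
      m.IsOptimalPlan (l, x) (m.strategyPlan σ (l, x)) ∧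
        m.utility (l, x) (m.strategyPlan σ (l, x)) = (V x : ℝ) := by
    intro σ hσ l x hx
    have hu := utility_strategyPlan h hV₀ hVB (σ := σ)
      (fun l x hx => by rw [hσ l x hx]; exact hτ x hx)
      (fun l x hx => by rw [hσ l x hx]; exact hatt l x hx) l hx
    exact ⟨⟨hu.1, fun b hb => (hbound l x hx b hb).trans hu.2.ge⟩, hu.2⟩
  -- An optimal plan earns `V x`, so its first action is worth `V x` as well.
  have hfirst : ∀ l x, 0 ≤ x → ∀ a, m.IsOptimalPlan (l, x) a →
      (a 0).improve < (τ x).improve ∨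
        ((a 0).improve = (τ x).improve ∧ (a 0).game ≤ (τ x).game) := by
    intro l x hx a ha
    refine hlex l x (a 0) hx (ha.1 0) (le_antisymm (hbell l x _ hx (ha.1 0)) ?_)
    have hτu := hopt (fun _ => τ) (fun _ _ _ => rfl) l x hx
    rw [← EReal.coe_le_coe_iff, ← hτu.2]
    exact (ha.2 _ hτu.1.1).trans (utility_le_actionValue h hV₀ hbell hx ha.1)
  constructor
  · intro hσ l x hx
    have h₁ := hfirst l x hx _ (hσ l x hx).1
    have h₂ := (hσ l x hx).2 _ (hopt (fun _ => τ) (fun _ _ _ => rfl) l x hx).1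
    simp only [strategyPlan, strategyState] at h₁ h₂
    rcases h₁ with h₁ | h₁ <;> rcases h₂ with h₂ | h₂
    · exact absurd h₁ h₂.not_gt
    · exact absurd h₂.1 h₁.ne'
    · exact absurd h₁.1 h₂.ne'
    · exact Action.ext h₁.1 (le_antisymm h₁.2 h₂.2)
  · intro hσ l x hx
    refine ⟨(hopt σ hσ l x hx).1, fun a ha => ?_⟩
    rw [hσ l x hx]
    exact hfirst l x hx a ha

/-! ### The value function -/

/-- The value of gaming up to the threshold at the attribute `x`, when continuation attributes are
worth `V`. -/
def gameValue (m : Model) (V : ℝ → ℝ) (x : ℝ) : ℝ :=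
  m.r - m.cMinus * (m.μ - x) + m.β * V (m.γ * x + m.δ)

/-- The value of improving up to the threshold at the attribute `x`, when continuation attributes
are worth `V`. -/
def improveValue (m : Model) (V : ℝ → ℝ) (x : ℝ) : ℝ :=
  m.r - m.cPlus * (m.μ - x) + m.β * V (m.γ * m.μ + m.δ)

/-- The Bellman operator of the problem in which the agent makes no effort from the threshold on,
and below it either games up to the threshold, or improves up to the threshold, or gives up for
good (with value `0`). -/
def bellman (m : Model) (V : ℝ → ℝ) (x : ℝ) : ℝ :=
  if m.μ ≤ x then m.r + m.β * V (m.γ * x + m.δ)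
  else max 0 (max (m.gameValue V x) (m.improveValue V x))

/-- The properties of a candidate value function that the Bellman operator preserves. -/
structure Regular (m : Model) (V : ℝ → ℝ) : Prop where
  nonneg : ∀ x, 0 ≤ V x
  le_bound : ∀ x, V x ≤ m.r / (1 - m.β)
  mono : Monotone V
  convex : ConvexOn ℝ (Set.Iic m.μ) V
  lip : ∀ x y, x ≤ y → V y ≤ V x + m.cPlus * (y - x)

lemma Valid.one_sub_β_pos (h : m.Valid) : 0 < 1 - m.β := sub_pos.2 h.β_lt_one

lemma Valid.one_sub_γ_pos (h : m.Valid) : 0 < 1 - m.γ := sub_pos.2 h.γ_lt_one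

lemma Valid.δ_le (h : m.Valid) : m.δ ≤ (1 - m.γ) * m.μ := by
  have := (div_le_iff₀ h.one_sub_γ_pos).1 h.threshold
  linarith

/-- Below the threshold the next attribute is below the threshold, too. -/
lemma Valid.next_le (h : m.Valid) {x : ℝ} (hx : x ≤ m.μ) : m.γ * x + m.δ ≤ m.μ := by
  have := mul_le_mul_of_nonneg_left hx h.γ_pos.le
  linarith [h.δ_le]

lemma bellman_eq_max (h : m.Valid) {V : ℝ → ℝ} (hV : ∀ x, 0 ≤ V x) {x : ℝ} (hx : x ≤ m.μ) :
    m.bellman V x = max 0 (max (m.gameValue V x) (m.improveValue V x)) := by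
  rw [bellman]
  split_ifs with hμ
  · obtain rfl : x = m.μ := le_antisymm hx hμ
    have := mul_nonneg h.β_pos.le (hV (m.γ * m.μ + m.δ))
    rw [gameValue, improveValue, sub_self, mul_zero, mul_zero, sub_zero, max_self,
      max_eq_right (add_nonneg h.r_pos.le this)]
  · rfl

lemma bellman_monotone (h : m.Valid) : Monotone m.bellman := by
  intro V W hVW x
  have hβ : ∀ z, m.β * V z ≤ m.β * W z := fun z => mul_le_mul_of_nonneg_left (hVW z) h.β_pos.le
  simp only [bellman, gameValue, improveValue]
  split_ifs
  · linarith [hβ (m.γ * x + m.δ)]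
  · exact max_le_max le_rfl (max_le_max (by linarith [hβ (m.γ * x + m.δ)])
      (by linarith [hβ (m.γ * m.μ + m.δ)]))

lemma convexOn_bellman (h : m.Valid) {V : ℝ → ℝ} (hV : m.Regular V) :
    ConvexOn ℝ (Set.Iic m.μ) (m.bellman V) := by
  have hid : ConvexOn ℝ (Set.Iic m.μ) (fun x : ℝ => x) := convexOn_id (convex_Iic _)
  have hlin : ∀ c k : ℝ, 0 ≤ c → ConvexOn ℝ (Set.Iic m.μ) (fun x : ℝ => c * x + k) :=
    fun c k hc => (hid.smul hc).add_const k
  have hcomp : ConvexOn ℝ (Set.Iic m.μ) (fun x => V (m.γ * x + m.δ)) := by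
    refine ⟨convex_Iic _, fun x hx y hy a b ha hb hab => ?_⟩
    have := hV.convex.2 (h.next_le hx) (h.next_le hy) ha hb hab
    refine le_trans (le_of_eq (congrArg V ?_)) this
    simp only [smul_eq_mul]
    linear_combination (-m.δ) * hab
  have hgame : ConvexOn ℝ (Set.Iic m.μ) (m.gameValue V) := by
    refine ((hlin m.cMinus (m.r - m.cMinus * m.μ) h.cMinus_pos.le).add
      (hcomp.smul h.β_pos.le)).congr fun x _ => ?_
    simp only [Pi.add_apply, smul_eq_mul, gameValue]; ring
  have himp : ConvexOn ℝ (Set.Iic m.μ) (m.improveValue V) := by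
    refine (hlin m.cPlus (m.r - m.cPlus * m.μ + m.β * V (m.γ * m.μ + m.δ))
      h.cPlus_pos.le).congr fun x _ => ?_
    simp only [improveValue]; ring
  refine ((convexOn_const 0 (convex_Iic _)).sup (hgame.sup himp)).congr fun x hx => ?_
  rw [bellman_eq_max h hV.nonneg hx]
  rfl

/-- A function that is convex below the threshold and lies above the line of slope `cPlus` through
its value at the threshold has slopes at most `cPlus` below the threshold. -/
lemma le_add_of_convexOn {V : ℝ → ℝ} (hV : ConvexOn ℝ (Set.Iic m.μ) V)
    (hline : ∀ x ≤ m.μ, V m.μ ≤ V x + m.cPlus * (m.μ - x)) {x y : ℝ} (hxy : x ≤ y)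
    (hy : y ≤ m.μ) : V y ≤ V x + m.cPlus * (y - x) := by
  rcases hxy.eq_or_lt with rfl | hxy
  · simp
  rcases hy.eq_or_lt with rfl | hy
  · exact hline x hxy.le
  have hs := hV.slope_mono_adjacent (x := x) (z := m.μ) (hxy.le.trans hy.le) Set.self_mem_Iic hxy hy
  have hb : (V m.μ - V y) / (m.μ - y) ≤ m.cPlus := by
    rw [div_le_iff₀ (sub_pos.2 hy)]
    linarith [hline y hy.le]
  have := (div_le_iff₀ (sub_pos.2 hxy)).1 (hs.trans hb)
  linarith

lemma regular_bellman (h : m.Valid) {V : ℝ → ℝ} (hV : m.Regular V) : m.Regular (m.bellman V) := by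
  have hB : m.r + m.β * (m.r / (1 - m.β)) = m.r / (1 - m.β) := by
    have := h.one_sub_β_pos.ne'
    field_simp; ring
  have hβV : ∀ z, 0 ≤ m.β * V z := fun z => mul_nonneg h.β_pos.le (hV.nonneg z)
  have hβB : ∀ z, m.β * V z ≤ m.β * (m.r / (1 - m.β)) :=
    fun z => mul_le_mul_of_nonneg_left (hV.le_bound z) h.β_pos.le
  have hβm : ∀ y z, y ≤ z → m.β * V y ≤ m.β * V z :=
    fun y z hyz => mul_le_mul_of_nonneg_left (hV.mono hyz) h.β_pos.le
  have hγ : ∀ x y, x ≤ y → m.γ * x + m.δ ≤ m.γ * y + m.δ := fun x y hxy => by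
    have := mul_le_mul_of_nonneg_left hxy h.γ_pos.le
    linarith
  have hconv := convexOn_bellman h hV
  have hμval : m.bellman V m.μ = m.r + m.β * V (m.γ * m.μ + m.δ) := if_pos le_rfl
  have hlow : ∀ x y, x ≤ y → y ≤ m.μ → m.bellman V y ≤ m.bellman V x + m.cPlus * (y - x) := by
    intro x y hxy hy
    refine le_add_of_convexOn hconv (fun x hx => ?_) hxy hy
    rw [hμval, bellman_eq_max h hV.nonneg hx]
    have h₁ : m.improveValue V x ≤ max 0 (max (m.gameValue V x) (m.improveValue V x)) :=
      (le_max_right _ _).trans (le_max_right _ _)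
    have h₂ : m.improveValue V x =
      m.r - m.cPlus * (m.μ - x) + m.β * V (m.γ * m.μ + m.δ) := rfl
    linarith
  have hhigh : ∀ x y, x ≤ y → m.μ ≤ x → m.bellman V y ≤ m.bellman V x + m.cPlus * (y - x) := by
    intro x y hxy hx
    rw [bellman, if_pos (hx.trans hxy), bellman, if_pos hx]
    have h₁ := mul_le_mul_of_nonneg_left (hV.lip _ _ (hγ x y hxy)) h.β_pos.le
    have h₂ : m.β * m.γ * (m.cPlus * (y - x)) ≤ 1 * (m.cPlus * (y - x)) :=
      mul_le_mul_of_nonneg_right (mul_le_one₀ h.β_lt_one.le h.γ_pos.le h.γ_lt_one.le)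
        (mul_nonneg h.cPlus_pos.le (sub_nonneg.2 hxy))
    linarith
  refine ⟨fun x => ?_, fun x => ?_, fun x y hxy => ?_, hconv, fun x y hxy => ?_⟩
  · rw [bellman]
    split_ifs
    · exact add_nonneg h.r_pos.le (hβV _)
    · exact le_max_left _ _
  · rw [bellman]
    split_ifs with hx
    · linarith [hβB (m.γ * x + m.δ)]
    · have hx' : 0 ≤ m.μ - x := by linarith
      have h₁ := mul_nonneg h.cMinus_pos.le hx'
      have h₂ := mul_nonneg h.cPlus_pos.le hx'
      refine max_le ((hV.nonneg x).trans (hV.le_bound x)) (max_le ?_ ?_)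
      · rw [gameValue]; linarith [hβB (m.γ * x + m.δ)]
      · rw [improveValue]; linarith [hβB (m.γ * m.μ + m.δ)]
  · by_cases hy : m.μ ≤ y
    · by_cases hx : m.μ ≤ x
      · rw [bellman, if_pos hx, bellman, if_pos hy]
        linarith [hβm _ _ (hγ x y hxy)]
      · rw [bellman, if_neg hx, bellman, if_pos hy]
        have hx' : 0 ≤ m.μ - x := by linarith
        have h₁ := mul_nonneg h.cMinus_pos.le hx'
        have h₂ := mul_nonneg h.cPlus_pos.le hx'
        refine max_le (add_nonneg h.r_pos.le (hβV _)) (max_le ?_ ?_)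
        · rw [gameValue]; linarith [hβm _ _ (hγ x y hxy)]
        · rw [improveValue]; linarith [hβm _ _ (hγ m.μ y hy)]
    · have hx : ¬ m.μ ≤ x := fun hx => hy (hx.trans hxy)
      rw [bellman, if_neg hx, bellman, if_neg hy]
      have h₁ := mul_le_mul_of_nonneg_left hxy h.cMinus_pos.le
      have h₂ := mul_le_mul_of_nonneg_left hxy h.cPlus_pos.le
      refine max_le_max le_rfl (max_le_max ?_ ?_)
      · rw [gameValue, gameValue]; linarith [hβm _ _ (hγ x y hxy)]
      · rw [improveValue, improveValue]; linarith
  · rcases le_total y m.μ with hy | hy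
    · exact hlow x y hxy hy
    rcases le_total m.μ x with hx | hx
    · exact hhigh x y hxy hx
    linarith [hlow x m.μ hx le_rfl, hhigh m.μ y hy le_rfl]

/-- Value iteration from `0`. -/
def valueIter (m : Model) (n : ℕ) : ℝ → ℝ := m.bellman^[n] 0

/-- The value function: the limit of value iteration. -/
def value (m : Model) (x : ℝ) : ℝ := ⨆ n, m.valueIter n x

lemma regular_valueIter (h : m.Valid) (n : ℕ) : m.Regular (m.valueIter n) := by
  induction n with
  | zero =>
    exact ⟨fun x => le_rfl, fun x => (div_pos h.r_pos h.one_sub_β_pos).le, monotone_const,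
      convexOn_const 0 (convex_Iic _), fun x y hxy => by
        simpa [valueIter] using mul_nonneg h.cPlus_pos.le (sub_nonneg.2 hxy)⟩
  | succ n ih =>
    rw [valueIter, Function.iterate_succ_apply']
    exact regular_bellman h ih

lemma tendsto_valueIter (h : m.Valid) (x : ℝ) :
    Filter.Tendsto (fun n => m.valueIter n x) Filter.atTop (nhds (m.value x)) := by
  refine tendsto_atTop_ciSup (fun i j hij => ?_)
    ⟨m.r / (1 - m.β), fun y ⟨n, hn⟩ => hn ▸ (regular_valueIter h n).le_bound x⟩
  exact (bellman_monotone h).monotone_iterate_of_le_map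
    (fun x => (regular_valueIter h 1).nonneg x) hij x

lemma regular_value (h : m.Valid) : m.Regular m.value := by
  have ht := tendsto_valueIter h
  have hr := regular_valueIter h
  refine ⟨fun x => ge_of_tendsto' (ht x) fun n => (hr n).nonneg x,
    fun x => le_of_tendsto' (ht x) fun n => (hr n).le_bound x,
    fun x y hxy => le_of_tendsto_of_tendsto' (ht x) (ht y) fun n => (hr n).mono hxy,
    ⟨convex_Iic _, fun x hx y hy a b ha hb hab => ?_⟩,
    fun x y hxy => le_of_tendsto_of_tendsto' (ht y) ((ht x).add_const _)
      fun n => (hr n).lip x y hxy⟩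
  exact le_of_tendsto_of_tendsto' (ht _) (((ht x).const_smul a).add ((ht y).const_smul b))
    fun n => (hr n).convex.2 hx hy ha hb hab

lemma bellman_value (h : m.Valid) : m.bellman m.value = m.value := by
  funext x
  have ht := tendsto_valueIter h
  have h₁ : Filter.Tendsto (fun n => m.valueIter (n + 1) x) Filter.atTop (nhds (m.value x)) :=
    (ht x).comp (Filter.tendsto_add_atTop_nat 1)
  refine tendsto_nhds_unique ?_ h₁
  have e : ∀ n, m.valueIter (n + 1) x = m.bellman (m.valueIter n) x := fun n => by
    rw [valueIter, Function.iterate_succ_apply', ← valueIter]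
  simp only [e, bellman, gameValue, improveValue]
  split_ifs
  · exact ((ht _).const_mul _).const_add _
  · exact tendsto_const_nhds.max
      ((((ht _).const_mul _).const_add _).max (((ht _).const_mul _).const_add _))

/-! ### Bellman's equation and its greedy strategy -/

lemma value_of_le (h : m.Valid) {x : ℝ} (hx : m.μ ≤ x) :
    m.value x = m.r + m.β * m.value (m.γ * x + m.δ) := by
  conv_lhs => rw [← bellman_value h, bellman, if_pos hx]

lemma value_eq_max (h : m.Valid) {x : ℝ} (hx : x ≤ m.μ) :
    m.value x = max 0 (max (m.gameValue m.value x) (m.improveValue m.value x)) := by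
  conv_lhs => rw [← bellman_value h, bellman_eq_max h (regular_value h).nonneg hx]

lemma gameValue_le (h : m.Valid) {x : ℝ} (hx : x ≤ m.μ) : m.gameValue m.value x ≤ m.value x := by
  rw [value_eq_max h hx]
  exact (le_max_left _ _).trans (le_max_right _ _)

/-- The amount by which the value function exceeds the value of improving up to the threshold. -/
def excess (m : Model) (x : ℝ) : ℝ := m.value x - (m.value m.μ - m.cPlus * (m.μ - x))

lemma improveValue_eq (h : m.Valid) (x : ℝ) :
    m.improveValue m.value x = m.value m.μ - m.cPlus * (m.μ - x) := by
  rw [improveValue, value_of_le h le_rfl]; ring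

lemma excess_nonneg (h : m.Valid) {x : ℝ} (hx : x ≤ m.μ) : 0 ≤ m.excess x := by
  rw [excess, ← improveValue_eq h, sub_nonneg, value_eq_max h hx]
  exact (le_max_right _ _).trans (le_max_right _ _)

lemma excess_threshold (m : Model) : m.excess m.μ = 0 := by
  rw [excess]; ring

lemma convexOn_excess (h : m.Valid) : ConvexOn ℝ (Set.Iic m.μ) m.excess := by
  have hlin : ConvexOn ℝ (Set.Iic m.μ) (fun x : ℝ => -(m.value m.μ - m.cPlus * (m.μ - x))) := by
    refine ⟨convex_Iic _, fun x _ y _ a b _ _ hab => le_of_eq ?_⟩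
    simp only [smul_eq_mul]
    linear_combination (m.value m.μ - m.cPlus * m.μ) * hab
  exact ((regular_value h).convex.add hlin).congr fun x _ => by
    simp only [Pi.add_apply, excess]; ring

/-- Since the excess is convex, nonnegative, and zero at the threshold, it decreases strictly as
long as it is positive. -/
lemma excess_lt (h : m.Valid) {x y : ℝ} (hxy : x < y) (hy : y ≤ m.μ) (hx : 0 < m.excess x) :
    m.excess y < m.excess x := by
  rcases hy.eq_or_lt with rfl | hy
  · rwa [excess_threshold]
  have hs := (convexOn_excess h).slope_mono_adjacent (x := x) (z := m.μ) (hxy.le.trans hy.le)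
    Set.self_mem_Iic hxy hy
  by_contra! hle
  have h₁ : 0 ≤ (m.excess y - m.excess x) / (y - x) :=
    div_nonneg (sub_nonneg.2 hle) (sub_pos.2 hxy).le
  have h₂ : (m.excess m.μ - m.excess y) / (m.μ - y) < 0 := by
    rw [excess_threshold]
    exact div_neg_of_neg_of_pos (by linarith) (sub_pos.2 hy)
  linarith

lemma excess_anti (h : m.Valid) {x y : ℝ} (hxy : x ≤ y) (hy : y ≤ m.μ) :
    m.excess y ≤ m.excess x := by
  rcases hxy.eq_or_lt with rfl | hlt
  · exact le_rfl
  rcases (excess_nonneg h (hxy.trans hy)).eq_or_lt' with h0 | hpos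
  · -- The lower end has excess `0`, so convexity leaves no room for a positive excess at `y`.
    by_contra! hlt'
    rcases hy.eq_or_lt with rfl | hy'
    · linarith [excess_threshold m]
    have hs := (convexOn_excess h).slope_mono_adjacent (x := x) (z := m.μ) (hxy.trans hy)
      Set.self_mem_Iic hlt hy'
    have h₁ : 0 < (m.excess y - m.excess x) / (y - x) :=
      div_pos (sub_pos.2 hlt') (sub_pos.2 hlt)
    have h₂ : (m.excess m.μ - m.excess y) / (m.μ - y) < 0 := by
      rw [excess_threshold]
      exact div_neg_of_neg_of_pos (by linarith) (sub_pos.2 hy')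
    linarith
  · exact (excess_lt h hlt hy hpos).le

/-- Above the threshold the value function grows at a rate below `cPlus`, so that improvement
does not pay there. -/
lemma value_lt_of_threshold_le (h : m.Valid) {x y : ℝ} (hx : m.μ ≤ x) (hxy : x < y) :
    m.value y < m.value x + m.cPlus * (y - x) := by
  rw [value_of_le h hx, value_of_le h (hx.trans hxy.le)]
  have h₀ : m.γ * x + m.δ ≤ m.γ * y + m.δ := by
    linarith [mul_le_mul_of_nonneg_left hxy.le h.γ_pos.le]
  have h₁ := mul_le_mul_of_nonneg_left ((regular_value h).lip _ _ h₀) h.β_pos.le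
  have h₂ : m.β * m.γ * (m.cPlus * (y - x)) < 1 * (m.cPlus * (y - x)) :=
    mul_lt_mul_of_pos_right
      (mul_lt_one_of_nonneg_of_lt_one_left h.β_pos.le h.β_lt_one h.γ_lt_one.le)
      (mul_pos h.cPlus_pos (sub_pos.2 hxy))
  linarith

lemma actionValue_of_pass (V : ℝ → ℝ) (l : Level) (x : ℝ) (a : Action)
    (ha : m.μ ≤ x + a.improve + a.game) :
    m.actionValue V (l, x) a = m.r - m.cPlus * a.improve - m.cMinus * a.game +
      m.β * V (m.γ * (x + a.improve) + m.δ) := by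
  simp only [actionValue, step, nextLevel_eq, if_pos ha, reward, Level.rank, cost]
  rw [mul_one, mul_one]; ring

lemma actionValue_of_fail (V : ℝ → ℝ) (l : Level) (x : ℝ) (a : Action)
    (ha : x + a.improve + a.game < m.μ) :
    m.actionValue V (l, x) a = -m.cPlus * a.improve - m.cMinus * a.game +
      m.β * V (m.γ * (x + a.improve)) := by
  simp only [actionValue, step, nextLevel_eq, if_neg ha.not_ge, reward, Level.rank, cost]
  rw [mul_zero, mul_zero, add_zero]; ring

/-- Failing the test wastes time: since the value function is monotone, an action that fails is
worth at most `β` times the value of the improved attribute, minus the cost. -/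
lemma actionValue_fail_le (h : m.Valid) (l : Level) {x : ℝ} (hx : 0 ≤ x) {a : Action}
    (ha : 0 ≤ a.improve ∧ 0 ≤ a.game) (hf : x + a.improve + a.game < m.μ) :
    m.actionValue m.value (l, x) a ≤
      -m.cPlus * a.improve - m.cMinus * a.game + m.β * m.value (x + a.improve) := by
  rw [actionValue_of_fail _ _ _ _ hf]
  have hz : m.γ * (x + a.improve) ≤ x + a.improve :=
    mul_le_of_le_one_left (add_nonneg hx ha.1) h.γ_lt_one.le
  linarith [mul_le_mul_of_nonneg_left ((regular_value h).mono hz) h.β_pos.le]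

lemma actionValue_le_value (h : m.Valid) (l : Level) (x : ℝ) (a : Action) (hx : 0 ≤ x)
    (ha : 0 ≤ a.improve ∧ 0 ≤ a.game) : m.actionValue m.value (l, x) a ≤ m.value x := by
  have hlip := (regular_value h).lip x (x + a.improve) (by linarith [ha.1])
  have hg := mul_nonneg h.cMinus_pos.le ha.2
  rcases lt_or_ge (x + a.improve + a.game) m.μ with hf | hp
  · have h₁ := actionValue_fail_le h l hx ha hf
    have h₂ := mul_le_of_le_one_left ((regular_value h).nonneg (x + a.improve)) h.β_lt_one.le
    linarith
  · rw [actionValue_of_pass _ _ _ _ hp]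
    rcases le_or_gt m.μ (x + a.improve) with hz | hz
    · linarith [value_of_le h hz]
    · have h₁ := gameValue_le h hz.le
      have h₂ : m.cMinus * (m.μ - (x + a.improve)) ≤ m.cMinus * a.game :=
        mul_le_mul_of_nonneg_left (by linarith) h.cMinus_pos.le
      rw [gameValue] at h₁
      linarith

/-- The greedy choice below the threshold, with the ties broken: improve up to the threshold if
that is optimal; otherwise game up to the threshold if that is optimal; otherwise do nothing. -/
def selector (m : Model) (x : ℝ) : Action :=
  open Classical in
  if m.μ ≤ x then ⟨0, 0⟩
  else if m.excess x = 0 then ⟨m.μ - x, 0⟩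
  else if m.value x = m.gameValue m.value x then ⟨0, m.μ - x⟩
  else ⟨0, 0⟩

lemma selector_nonneg (m : Model) (x : ℝ) :
    0 ≤ (m.selector x).improve ∧ 0 ≤ (m.selector x).game := by
  rw [selector]
  split_ifs with h₁ h₂ h₃ <;> simp <;> linarith

lemma value_eq_zero_of_ne (h : m.Valid) {x : ℝ} (hx : x ≤ m.μ) (h₁ : m.excess x ≠ 0)
    (h₂ : m.value x ≠ m.gameValue m.value x) : m.value x = 0 := by
  rw [excess, ← improveValue_eq h, sub_ne_zero] at h₁
  have := value_eq_max h hx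
  rcases max_choice 0 (max (m.gameValue m.value x) (m.improveValue m.value x)) with e | e
  · rw [this, e]
  · rcases max_choice (m.gameValue m.value x) (m.improveValue m.value x) with e' | e'
    · exact absurd (this.trans (e.trans e')) h₂
    · exact absurd (this.trans (e.trans e')) h₁

lemma actionValue_selector (h : m.Valid) (l : Level) (x : ℝ) (hx : 0 ≤ x) :
    m.actionValue m.value (l, x) (m.selector x) = m.value x := by
  rw [selector]
  split_ifs with h₁ h₂ h₃
  · rw [actionValue_of_pass _ _ _ _ (by simpa using h₁), value_of_le h h₁]
    simp
  · rw [actionValue_of_pass _ _ _ _ (by simp)]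
    rw [excess, value_of_le h le_rfl] at h₂
    simp only [add_sub_cancel]
    linarith
  · rw [actionValue_of_pass _ _ _ _ (by simp), h₃, gameValue]
    simp
  · have h0 := value_eq_zero_of_ne h (not_le.1 h₁).le h₂ h₃
    have hz : m.value (m.γ * x) = 0 :=
      le_antisymm (((regular_value h).mono (mul_le_of_le_one_left hx h.γ_lt_one.le)).trans h0.le)
        ((regular_value h).nonneg _)
    rw [actionValue_of_fail _ _ _ _ (by simpa using h₁), h0]
    simp [hz]

lemma selector_lex (h : m.Valid) (l : Level) (x : ℝ) (a : Action) (hx : 0 ≤ x)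
    (ha : 0 ≤ a.improve ∧ 0 ≤ a.game) (hopt : m.actionValue m.value (l, x) a = m.value x) :
    a.improve < (m.selector x).improve ∨
      (a.improve = (m.selector x).improve ∧ a.game ≤ (m.selector x).game) := by
  have hlip := (regular_value h).lip x (x + a.improve) (by linarith [ha.1])
  have hg := mul_nonneg h.cMinus_pos.le ha.2
  have hi := mul_nonneg h.cPlus_pos.le ha.1
  have hsel := selector_nonneg m x
  rcases lt_or_ge (x + a.improve + a.game) m.μ with hf | hp
  · -- A failing action can be optimal only if the improved attribute is worthless.
    have h₁ := actionValue_fail_le h l hx ha hf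
    rw [hopt] at h₁
    have h₂ : (1 - m.β) * m.value (x + a.improve) ≤ 0 := by linarith
    have h₃ : m.value (x + a.improve) ≤ 0 := nonpos_of_mul_nonpos_right h₂ h.one_sub_β_pos
    have h₄ := mul_nonpos_of_nonneg_of_nonpos h.β_pos.le h₃
    have h₅ := (regular_value h).nonneg x
    have e₁ : a.improve = 0 := by
      have : m.cPlus * a.improve = 0 := by linarith
      exact (mul_eq_zero.1 this).resolve_left h.cPlus_pos.ne'
    have e₂ : a.game = 0 := by
      have : m.cMinus * a.game = 0 := by linarith
      exact (mul_eq_zero.1 this).resolve_left h.cMinus_pos.ne'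
    rw [e₁, e₂]
    rcases hsel.1.eq_or_lt with e | e
    · exact Or.inr ⟨e, hsel.2⟩
    · exact Or.inl e
  rw [actionValue_of_pass _ _ _ _ hp] at hopt
  rcases le_or_gt m.μ (x + a.improve) with hz | hz
  · rw [value_of_le h hz] at hlip
    have e₂ : a.game = 0 := by
      have : m.cMinus * a.game = 0 := by linarith
      exact (mul_eq_zero.1 this).resolve_left h.cMinus_pos.ne'
    have hval : m.value x = m.value (x + a.improve) - m.cPlus * a.improve := by
      rw [value_of_le h hz, ← hopt, e₂]; ring
    rcases le_or_gt m.μ x with hμ | hμ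
    · have e₁ : a.improve = 0 := by
        by_contra hne
        have := value_lt_of_threshold_le h hμ
          (show x < x + a.improve by linarith [lt_of_le_of_ne ha.1 (Ne.symm hne)])
        linarith
      rw [selector, if_pos hμ]
      exact Or.inr ⟨e₁, e₂.le⟩
    · have e₁ : x + a.improve = m.μ := by
        by_contra hne
        have h₁ := value_lt_of_threshold_le h le_rfl (lt_of_le_of_ne hz (Ne.symm hne))
        have h₂ := excess_nonneg h hμ.le
        rw [excess] at h₂
        linarith
      have hex : m.excess x = 0 := by
        rw [excess, hval, e₁]
        linear_combination (-m.cPlus) * e₁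
      rw [selector, if_neg hμ.not_ge, if_pos hex]
      exact Or.inr ⟨by simp only; linarith, e₂.le⟩
  · have hμ : x < m.μ := by linarith [ha.1]
    have h₁ := gameValue_le h hz.le
    rw [gameValue] at h₁
    have e₂ : a.game = m.μ - (x + a.improve) := by
      by_contra hne
      have : m.cMinus * (m.μ - (x + a.improve)) < m.cMinus * a.game :=
        mul_lt_mul_of_pos_left (lt_of_le_of_ne (by linarith) (Ne.symm hne)) h.cMinus_pos
      linarith
    rw [selector, if_neg hμ.not_ge]
    by_cases hex : m.excess x = 0
    · rw [if_pos hex]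
      exact Or.inl (by simp only; linarith)
    rw [if_neg hex]
    have e₁ : a.improve = 0 := by
      by_contra hne
      -- Otherwise the excess would be the same at `x` and at `x + a.improve`.
      have hlt := excess_lt h
        (show x < x + a.improve by linarith [lt_of_le_of_ne ha.1 (Ne.symm hne)]) hz.le
        (lt_of_le_of_ne (excess_nonneg h hμ.le) (Ne.symm hex))
      rw [excess, excess] at hlt
      rw [e₂] at hopt
      linarith
    have hgame : m.value x = m.gameValue m.value x := by
      rw [gameValue, ← hopt, e₂, e₁]
      simp
    rw [if_pos hgame]
    exact Or.inr ⟨e₁, by rw [e₂, e₁, add_zero]⟩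

theorem isOptimalStrategy_iff_selector (h : m.Valid) (σ : Level → ℝ → Action) :
    m.IsOptimalStrategy σ ↔ ∀ l x, 0 ≤ x → σ l x = m.selector x :=
  isOptimalStrategy_iff_of_bellman h (regular_value h).nonneg (regular_value h).le_bound
    (fun x _ => selector_nonneg m x) (actionValue_le_value h) (actionValue_selector h)
    (selector_lex h) σ

/-! ### When gaming is optimal -/

/-- Improving at `γ μ + δ` and at every later time is one way to continue from the threshold. -/
lemma le_value_threshold (h : m.Valid) :
    m.r - m.β * m.cPlus * ((1 - m.γ) * m.μ - m.δ) ≤ (1 - m.β) * m.value m.μ := by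
  have h₁ := mul_nonneg h.β_pos.le (excess_nonneg h (h.next_le le_rfl))
  have h₂ := value_of_le h (le_refl m.μ)
  rw [excess] at h₁
  linarith

/-- Against improving up to the threshold now, gaming now can gain only through the excess at the
next attribute. This uses that one unit of improvement pays off a part `β * γ` of its cost at the
next time. -/
lemma excess_le_of_game (h : m.Valid) {x : ℝ} (hx : x ≤ m.μ)
    (hg : m.value x = m.gameValue m.value x) : m.excess x ≤ m.β * m.excess (m.γ * x + m.δ) := by
  have h₁ := le_value_threshold h
  have h₂ := mul_nonneg (sub_pos.2 h.incentive).le (sub_nonneg.2 hx)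
  rw [excess, excess, hg, gameValue]
  linarith

/-- Where the attribute does not decrease under gaming, gaming is optimal only if improving is. -/
lemma excess_eq_zero_of_game (h : m.Valid) {x : ℝ} (hx : x ≤ m.μ) (hxz : x ≤ m.γ * x + m.δ)
    (hg : m.value x = m.gameValue m.value x) : m.excess x = 0 := by
  have h₁ := excess_le_of_game h hx hg
  have h₂ := mul_le_mul_of_nonneg_left (excess_anti h hxz (h.next_le hx)) h.β_pos.le
  have h₃ : (1 - m.β) * m.excess x ≤ 0 := by linarith
  exact le_antisymm (nonpos_of_mul_nonpos_right h₃ h.one_sub_β_pos) (excess_nonneg h hx)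

/-- Where the attribute does not increase under gaming, gaming is no better than collecting the
present gain for ever. -/
lemma value_le_of_game (h : m.Valid) {x : ℝ} (hzx : m.γ * x + m.δ ≤ x)
    (hg : m.value x = m.gameValue m.value x) :
    (1 - m.β) * m.value x ≤ m.r - m.cMinus * (m.μ - x) := by
  have h₁ := mul_le_mul_of_nonneg_left ((regular_value h).mono hzx) h.β_pos.le
  have h₂ := hg
  rw [gameValue] at h₂
  linarith

/-- If improving is worthwhile at `μ - r / cMinus`, where a single promotion just pays for
gaming, then gaming is never better than improving. -/
lemma excess_eq_zero_of_game_of_le (h : m.Valid) (hC : m.cPlus * (m.r / m.cMinus) ≤ m.value m.μ)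
    {x : ℝ} (hx : x ≤ m.μ) (hg : m.value x = m.gameValue m.value x) : m.excess x = 0 := by
  rcases le_total x (m.γ * x + m.δ) with hxz | hzx
  · exact excess_eq_zero_of_game h hx hxz hg
  by_contra hne
  have hpos : 0 < m.excess x := lt_of_le_of_ne (excess_nonneg h hx) (Ne.symm hne)
  have hr : m.cMinus * (m.r / m.cMinus) = m.r := mul_div_cancel₀ _ h.cMinus_pos.ne'
  have hD : m.γ * (m.δ / (1 - m.γ)) + m.δ = m.δ / (1 - m.γ) := by
    have := h.one_sub_γ_pos.ne'
    field_simp; ring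
  have hDx : m.δ / (1 - m.γ) ≤ x := by
    rw [div_le_iff₀ h.one_sub_γ_pos]; linarith
  have hV := value_le_of_game h hzx hg
  have hV₀ := mul_nonneg h.one_sub_β_pos.le ((regular_value h).nonneg x)
  have hx₀ : m.μ - m.r / m.cMinus ≤ x := by
    have : m.cMinus * (m.μ - x) ≤ m.cMinus * (m.r / m.cMinus) := by linarith
    linarith [le_of_mul_le_mul_left this h.cMinus_pos]
  -- At any `p ≤ x` beyond the break-even point, the value is positive and gaming is optimal.
  have key : ∀ p ≤ x, m.μ - m.r / m.cMinus ≤ p →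
      0 < m.excess p ∧ 0 < m.value p ∧ m.value p = m.gameValue m.value p := by
    intro p hp hp₀
    have h₁ : 0 < m.excess p := hpos.trans_le (excess_anti h hp hx)
    have h₂ : m.cPlus * (m.μ - p) ≤ m.cPlus * (m.r / m.cMinus) :=
      mul_le_mul_of_nonneg_left (by linarith) h.cPlus_pos.le
    have h₃ : 0 < m.value p := by
      have := h₁
      rw [excess] at this
      linarith
    refine ⟨h₁, h₃, ?_⟩
    by_contra hng
    exact h₃.ne' (value_eq_zero_of_ne h (hp.trans hx) h₁.ne' hng)
  rcases le_total (m.μ - m.r / m.cMinus) (m.δ / (1 - m.γ)) with hc | hc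
  · obtain ⟨h₁, -, h₃⟩ := key _ hDx hc
    exact h₁.ne' (excess_eq_zero_of_game h (hDx.trans hx) hD.ge h₃)
  · obtain ⟨-, h₂, h₃⟩ := key _ hx₀ le_rfl
    have hz : m.γ * (m.μ - m.r / m.cMinus) + m.δ ≤ m.μ - m.r / m.cMinus := by
      rw [div_le_iff₀ h.one_sub_γ_pos] at hc; linarith
    have h₄ := value_le_of_game h hz h₃
    have h₅ := mul_pos h.one_sub_β_pos h₂
    rw [sub_sub_cancel, hr] at h₄
    linarith

/-- If improving is worthwhile at `μ - r / cMinus`, then perpetual improvement is optimal from the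
threshold on. -/
lemma value_threshold_eq (h : m.Valid) (hC : m.cPlus * (m.r / m.cMinus) ≤ m.value m.μ) :
    (1 - m.β) * m.value m.μ = m.r - m.β * m.cPlus * ((1 - m.γ) * m.μ - m.δ) := by
  have hV := value_of_le h (le_refl m.μ)
  by_cases hex : m.excess (m.γ * m.μ + m.δ) = 0
  · rw [excess] at hex
    linear_combination m.β * hex + hV
  · have h0 := value_eq_zero_of_ne h (h.next_le le_rfl) hex
      (fun hg => hex (excess_eq_zero_of_game_of_le h hC (h.next_le le_rfl) hg))
    have h₁ : m.cMinus * (m.r / m.cMinus) < m.cPlus * (m.r / m.cMinus) :=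
      mul_lt_mul_of_pos_right h.cMinus_lt (div_pos h.r_pos h.cMinus_pos)
    rw [mul_div_cancel₀ _ h.cMinus_pos.ne'] at h₁
    rw [h0, mul_zero, add_zero] at hV
    linarith

/-! ### The optimal strategy as a function of the threshold -/

/-- The threshold, for `δ = 0`, at which perpetual improvement is worth `0` at the attribute
`μ - r / cMinus`. -/
def muLow (m : Model) : ℝ :=
  m.r * (m.cMinus - (1 - m.β) * m.cPlus) / (m.β * (1 - m.γ) * m.cPlus * m.cMinus)

lemma lt_muLow_add_iff (h : m.Valid) : m.μ < m.muLow + m.δ / (1 - m.γ) ↔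
    (1 - m.β) * (m.cPlus * (m.r / m.cMinus)) <
      m.r - m.β * m.cPlus * ((1 - m.γ) * m.μ - m.δ) := by
  have h₁ := h.one_sub_γ_pos
  have h₂ := h.β_pos
  have h₃ := h.cPlus_pos
  have h₄ := h.cMinus_pos
  have e : m.r - m.β * m.cPlus * ((1 - m.γ) * m.μ - m.δ) -
      (1 - m.β) * (m.cPlus * (m.r / m.cMinus)) =
      m.β * m.cPlus * (1 - m.γ) * (m.muLow + m.δ / (1 - m.γ) - m.μ) := by
    rw [muLow]; field_simp; ring
  rw [← sub_pos, ← sub_pos (b := (1 - m.β) * (m.cPlus * (m.r / m.cMinus))), e,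
    mul_pos_iff_of_pos_left (mul_pos (mul_pos h₂ h₃) h₁)]

lemma muLow_gt (h : m.Valid) : m.r / m.cMinus < m.muLow := by
  have h₁ := h.one_sub_γ_pos
  have h₂ := h.β_pos
  have h₃ := h.cPlus_pos
  have h₄ := h.cMinus_pos
  have e : m.muLow - m.r / m.cMinus = m.r * (m.cMinus - (1 - m.β * m.γ) * m.cPlus) /
      (m.β * (1 - m.γ) * m.cPlus * m.cMinus) := by
    rw [muLow]; field_simp; ring
  rw [← sub_pos, e]
  exact div_pos (mul_pos h.r_pos (sub_pos.2 h.incentive)) (by positivity)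

/-- Below `muLow` gaming is never needed, so the agent improves exactly where improving up to the
threshold has nonnegative value. -/
theorem selector_of_lt_muLow (h : m.Valid) (hμ : m.μ < m.muLow + m.δ / (1 - m.γ)) (x : ℝ)
    (hx : 0 ≤ x) : m.selector x =
      if max 0 (m.μ - m.value m.μ / m.cPlus) ≤ x ∧ x < m.μ then ⟨m.μ - x, 0⟩ else ⟨0, 0⟩ := by
  have hC : m.cPlus * (m.r / m.cMinus) ≤ m.value m.μ :=
    le_of_mul_le_mul_left (((lt_muLow_add_iff h).1 hμ).le.trans (le_value_threshold h))
      h.one_sub_β_pos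
  rw [selector]
  by_cases hxμ : m.μ ≤ x
  · rw [if_pos hxμ, if_neg fun hc => hc.2.not_ge hxμ]
  have hxμ' := not_le.1 hxμ
  have hline : max 0 (m.μ - m.value m.μ / m.cPlus) ≤ x ↔
      0 ≤ m.value m.μ - m.cPlus * (m.μ - x) := by
    rw [max_le_iff, and_iff_right hx, sub_le_comm, le_div_iff₀ h.cPlus_pos, sub_nonneg, mul_comm]
  have hng : m.excess x ≠ 0 → m.value x ≠ m.gameValue m.value x :=
    fun hne hg => hne (excess_eq_zero_of_game_of_le h hC hxμ'.le hg)
  have hiff : m.excess x = 0 ↔ max 0 (m.μ - m.value m.μ / m.cPlus) ≤ x := by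
    rw [hline]
    constructor
    · intro h0
      rw [excess, sub_eq_zero] at h0
      exact h0 ▸ (regular_value h).nonneg x
    · intro h0
      by_contra hne
      have hV := value_eq_zero_of_ne h hxμ'.le hne (hng hne)
      have := lt_of_le_of_ne (excess_nonneg h hxμ'.le) (Ne.symm hne)
      rw [excess, hV] at this
      linarith
  rw [if_neg hxμ]
  by_cases hex : m.excess x = 0
  · rw [if_pos hex, if_pos ⟨hiff.1 hex, hxμ'⟩]
  · rw [if_neg hex, if_neg (hng hex), if_neg fun hc => hex (hiff.2 hc.1)]

/-- In the regimes with gaming, the break-even point `μ - r / cMinus` lies above the attribute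
`δ / (1 - γ)`. -/
lemma restPoint_lt_breakEven (h : m.Valid) (hμ : m.muLow + m.δ / (1 - m.γ) ≤ m.μ) :
    m.δ / (1 - m.γ) < m.μ - m.r / m.cMinus := by
  linarith [muLow_gt h]

lemma breakEven_mem (h : m.Valid) (hμ : m.muLow + m.δ / (1 - m.γ) ≤ m.μ) :
    m.μ - m.r / m.cMinus ∈ Set.Icc 0 m.μ := by
  have h₁ := restPoint_lt_breakEven h hμ
  have h₂ := div_nonneg h.δ_nonneg h.one_sub_γ_pos.le
  have h₃ := div_pos h.r_pos h.cMinus_pos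
  exact ⟨by linarith, by linarith⟩

lemma next_breakEven_le (h : m.Valid) (hμ : m.muLow + m.δ / (1 - m.γ) ≤ m.μ) :
    m.γ * (m.μ - m.r / m.cMinus) + m.δ ≤ m.μ - m.r / m.cMinus := by
  have h₁ := restPoint_lt_breakEven h hμ
  rw [div_lt_iff₀ h.one_sub_γ_pos] at h₁
  linarith

lemma value_threshold_le (h : m.Valid) (hμ : m.muLow + m.δ / (1 - m.γ) ≤ m.μ) :
    m.value m.μ ≤ m.cPlus * (m.r / m.cMinus) := by
  by_contra! hlt
  have h₁ := value_threshold_eq h hlt.le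
  have h₂ := mul_lt_mul_of_pos_left hlt h.one_sub_β_pos
  rw [h₁, ← lt_muLow_add_iff h] at h₂
  exact h₂.not_ge hμ

lemma value_breakEven (h : m.Valid) (hμ : m.muLow + m.δ / (1 - m.γ) ≤ m.μ) :
    m.value (m.μ - m.r / m.cMinus) = 0 := by
  have h₀ := (regular_value h).nonneg (m.μ - m.r / m.cMinus)
  have hle := (breakEven_mem h hμ).2
  by_cases hex : m.excess (m.μ - m.r / m.cMinus) = 0
  · rw [excess, sub_sub_cancel] at hex
    linarith [value_threshold_le h hμ]
  by_cases hg : m.value (m.μ - m.r / m.cMinus) = m.gameValue m.value (m.μ - m.r / m.cMinus)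
  · have h₁ := value_le_of_game h (next_breakEven_le h hμ) hg
    rw [sub_sub_cancel, mul_div_cancel₀ _ h.cMinus_pos.ne', sub_self] at h₁
    exact le_antisymm (nonpos_of_mul_nonpos_right h₁ h.one_sub_β_pos) h₀
  · exact value_eq_zero_of_ne h hle hex hg

lemma value_eq_zero_of_le_breakEven (h : m.Valid) (hμ : m.muLow + m.δ / (1 - m.γ) ≤ m.μ) {x : ℝ}
    (hx : x ≤ m.μ - m.r / m.cMinus) : m.value x = 0 :=
  le_antisymm (((regular_value h).mono hx).trans (value_breakEven h hμ).le)
    ((regular_value h).nonneg x)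

/-- From `muLow` on, the agent makes an effort exactly from the break-even point on, and games
unless improving is optimal. -/
lemma selector_of_muLow_le (h : m.Valid) (hμ : m.muLow + m.δ / (1 - m.γ) ≤ m.μ) {x : ℝ}
    (hx : x < m.μ) [Decidable (m.excess x = 0)] [Decidable (m.μ - m.r / m.cMinus ≤ x)] :
    m.selector x = if m.excess x = 0 then ⟨m.μ - x, 0⟩
      else if m.μ - m.r / m.cMinus ≤ x then ⟨0, m.μ - x⟩ else ⟨0, 0⟩ := by
  have hr : m.cMinus * (m.r / m.cMinus) = m.r := mul_div_cancel₀ _ h.cMinus_pos.ne'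
  rw [selector, if_neg hx.not_ge]
  rcases le_or_gt (m.μ - m.r / m.cMinus) x with hx₀ | hx₀
  · by_cases hex : m.excess x = 0
    · rw [if_pos hex, if_pos hex]
    have hg : m.value x = m.gameValue m.value x := by
      by_contra hne
      have h₁ := value_eq_zero_of_ne h hx.le hex hne
      have h₂ := gameValue_le h hx.le
      refine hne (le_antisymm ?_ h₂)
      have h₃ : m.cMinus * (m.μ - x) ≤ m.cMinus * (m.r / m.cMinus) :=
        mul_le_mul_of_nonneg_left (by linarith) h.cMinus_pos.le
      have h₄ := mul_nonneg h.β_pos.le ((regular_value h).nonneg (m.γ * x + m.δ))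
      rw [h₁, gameValue]
      linarith
    rw [if_neg hex, if_neg hex, if_pos hg, if_pos hx₀]
  · have h₁ := value_eq_zero_of_le_breakEven h hμ hx₀.le
    have hex : m.excess x ≠ 0 := by
      have h₂ : m.cPlus * (m.r / m.cMinus) < m.cPlus * (m.μ - x) :=
        mul_lt_mul_of_pos_left (by linarith) h.cPlus_pos
      rw [excess, h₁]
      refine ne_of_gt ?_
      linarith [value_threshold_le h hμ]
    have hg : m.value x ≠ m.gameValue m.value x := by
      have h₂ : m.cMinus * (m.r / m.cMinus) < m.cMinus * (m.μ - x) :=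
        mul_lt_mul_of_pos_left (by linarith) h.cMinus_pos
      have h₃ : m.γ * x + m.δ ≤ m.μ - m.r / m.cMinus := by
        linarith [mul_le_mul_of_nonneg_left hx₀.le h.γ_pos.le, next_breakEven_le h hμ]
      rw [h₁, gameValue, value_eq_zero_of_le_breakEven h hμ h₃]
      refine ne_of_gt ?_
      linarith
    rw [if_neg hex, if_neg hex, if_neg hg, if_neg hx₀.not_ge]

lemma continuous_excess (h : m.Valid) : Continuous m.excess := by
  have hV : Continuous m.value := by
    refine (LipschitzWith.of_le_add_mul m.cPlus.toNNReal fun x y => ?_).continuous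
    rw [Real.coe_toNNReal _ h.cPlus_pos.le, Real.dist_eq]
    rcases le_total y x with hyx | hxy
    · rw [abs_of_nonneg (sub_nonneg.2 hyx)]
      exact (regular_value h).lip y x hyx
    · exact ((regular_value h).mono hxy).trans
        (le_add_of_nonneg_right (mul_nonneg h.cPlus_pos.le (abs_nonneg _)))
  unfold excess
  fun_prop

/-- The attributes at which improving is optimal form a closed interval ending at the threshold. -/
lemma exists_excess_eq_zero_iff (h : m.Valid) :
    ∃ y ∈ Set.Icc 0 m.μ, ∀ x ∈ Set.Icc 0 m.μ, m.excess x = 0 ↔ y ≤ x := by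
  have hμ : 0 ≤ m.μ := (div_nonneg h.δ_nonneg h.one_sub_γ_pos.le).trans h.threshold
  have hcomp : IsCompact (Set.Icc 0 m.μ ∩ {x | m.excess x = 0}) :=
    isCompact_Icc.inter_right (isClosed_eq (continuous_excess h) continuous_const)
  obtain ⟨y, hy⟩ := hcomp.exists_isLeast ⟨m.μ, ⟨hμ, le_rfl⟩, excess_threshold m⟩
  refine ⟨y, hy.1.1, fun x hx => ⟨fun h0 => hy.2 ⟨hx, h0⟩, fun hyx => ?_⟩⟩
  exact le_antisymm ((excess_anti h hyx hx.2).trans hy.1.2.le) (excess_nonneg h hx.2)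

theorem exists_selector_of_muLow_le (h : m.Valid) (hμ : m.muLow + m.δ / (1 - m.γ) ≤ m.μ) :
    ∃ y ∈ Set.Icc 0 m.μ, ∀ x, 0 ≤ x → m.selector x =
      if m.μ - m.r / m.cMinus ≤ x ∧ x < y then ⟨0, m.μ - x⟩
      else if y ≤ x ∧ x < m.μ then ⟨m.μ - x, 0⟩ else ⟨0, 0⟩ := by
  classical
  obtain ⟨y, hy, hiff⟩ := exists_excess_eq_zero_iff h
  refine ⟨y, hy, fun x hx => ?_⟩
  rcases le_or_gt m.μ x with hxμ | hxμ
  · rw [selector, if_pos hxμ, if_neg fun hc => (hc.2.trans_le hy.2).not_ge hxμ,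
      if_neg fun hc => hc.2.not_ge hxμ]
  rw [selector_of_muLow_le h hμ hxμ]
  rcases le_or_gt y x with hyx | hyx
  · rw [if_pos ((hiff x ⟨hx, hxμ.le⟩).2 hyx), if_neg fun hc => hc.2.not_ge hyx, if_pos ⟨hyx, hxμ⟩]
  · rw [if_neg fun h0 => hyx.not_ge ((hiff x ⟨hx, hxμ.le⟩).1 h0),
      if_neg (c := y ≤ x ∧ x < m.μ) fun hc => hyx.not_ge hc.1]
    simp only [hyx, and_true]

/-- If even an attribute at the threshold falls to the break-even point within one period, then
the value at the threshold is `r`, and gaming always beats improving. -/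
theorem selector_of_muHigh_le (h : m.Valid) (hμ : m.muLow + m.δ / (1 - m.γ) ≤ m.μ)
    (hμ' : m.r / (m.cMinus * (1 - m.γ)) + m.δ / (1 - m.γ) ≤ m.μ) (x : ℝ) : m.selector x =
      if m.μ - m.r / m.cMinus ≤ x ∧ x ≤ m.μ then ⟨0, m.μ - x⟩ else ⟨0, 0⟩ := by
  classical
  have hz : m.γ * m.μ + m.δ ≤ m.μ - m.r / m.cMinus := by
    rw [← div_div, ← add_div, div_le_iff₀ h.one_sub_γ_pos] at hμ'
    linarith
  have hV : m.value m.μ = m.r := by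
    rw [value_of_le h le_rfl, value_eq_zero_of_le_breakEven h hμ hz, mul_zero, add_zero]
  rcases lt_trichotomy x m.μ with hx | rfl | hx
  · have hex : m.excess x ≠ 0 := by
      have h₁ := gameValue_le h hx.le
      have h₂ := mul_nonneg h.β_pos.le ((regular_value h).nonneg (m.γ * x + m.δ))
      have h₃ := mul_lt_mul_of_pos_right h.cMinus_lt (sub_pos.2 hx)
      rw [gameValue] at h₁
      rw [excess, hV]
      refine ne_of_gt ?_
      linarith
    rw [selector_of_muLow_le h hμ hx, if_neg hex]
    simp only [hx.le, and_true]
  · rw [selector, if_pos le_rfl, if_pos ⟨(breakEven_mem h hμ).2, le_rfl⟩, sub_self]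
  · rw [selector, if_pos hx.le, if_neg fun hc => hc.2.not_gt hx]

end

end Model

end TwoLevel

theorem mainTheorem2 (β γ r cPlus cMinus : ℝ)
    (hβ₀ : 0 < β) (hβ₁ : β < 1) (hγ₀ : 0 < γ) (hγ₁ : γ < 1) (hr : 0 < r)
    (hc₀ : 0 < cMinus) (hc : cMinus < cPlus) (hinc : (1 - β * γ) * cPlus < cMinus) :
    ∃ μlow μhigh : ℝ, 0 ≤ μlow ∧ μlow ≤ μhigh ∧
      ∀ δ : ℝ, 0 ≤ δ → ∀ μ : ℝ, δ / (1 - γ) ≤ μ →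
        ∃ xlow ∈ Set.Icc 0 μ, ∃ xhigh ∈ Set.Icc 0 μ,
          (μ < μlow + δ / (1 - γ) →
            ∀ σ : TwoLevel.Level → ℝ → TwoLevel.Action,
              TwoLevel.Model.IsOptimalStrategy ⟨β, γ, δ, r, cPlus, cMinus, μ⟩ σ ↔
                ∀ l x, 0 ≤ x → σ l x =
                  if xlow ≤ x ∧ x < μ then ⟨μ - x, 0⟩ else ⟨0, 0⟩) ∧
          (μlow + δ / (1 - γ) ≤ μ → μ < μhigh + δ / (1 - γ) →
            ∀ σ : TwoLevel.Level → ℝ → TwoLevel.Action,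
              TwoLevel.Model.IsOptimalStrategy ⟨β, γ, δ, r, cPlus, cMinus, μ⟩ σ ↔
                ∀ l x, 0 ≤ x → σ l x =
                  if μ - r / cMinus ≤ x ∧ x < xhigh then ⟨0, μ - x⟩
                  else if xhigh ≤ x ∧ x < μ then ⟨μ - x, 0⟩ else ⟨0, 0⟩) ∧
          (μhigh + δ / (1 - γ) ≤ μ →
            ∀ σ : TwoLevel.Level → ℝ → TwoLevel.Action,
              TwoLevel.Model.IsOptimalStrategy ⟨β, γ, δ, r, cPlus, cMinus, μ⟩ σ ↔
                ∀ l x, 0 ≤ x → σ l x =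
                  if xlow ≤ x ∧ x ≤ μ then ⟨0, μ - x⟩ else ⟨0, 0⟩) := by
  -- `muLow` depends neither on `δ` nor on `μ`, so these may be set to `0` in its definition.
  let μlow : ℝ := TwoLevel.Model.muLow ⟨β, γ, 0, r, cPlus, cMinus, 0⟩
  have hvalid : ∀ δ : ℝ, 0 ≤ δ → ∀ μ : ℝ, δ / (1 - γ) ≤ μ →
      TwoLevel.Model.Valid ⟨β, γ, δ, r, cPlus, cMinus, μ⟩ := fun δ hδ μ hμ =>
    ⟨hβ₀, hβ₁, hγ₀, hγ₁, hr, hc₀, hc, hinc, hδ, hμ⟩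
  have hlow : 0 ≤ μlow :=
    (div_pos hr hc₀).le.trans (TwoLevel.Model.muLow_gt (hvalid 0 le_rfl 0 (by simp))).le
  refine ⟨μlow, max μlow (r / (cMinus * (1 - γ))), hlow, le_max_left _ _, fun δ hδ μ hμ => ?_⟩
  have h := hvalid δ hδ μ hμ
  have hμ₀ : 0 ≤ μ := (div_nonneg hδ (sub_pos.2 hγ₁).le).trans hμ
  have hiff := TwoLevel.Model.isOptimalStrategy_iff_selector h
  rcases lt_or_ge μ (μlow + δ / (1 - γ)) with hlt | hge
  · -- The second attribute plays no role in this regime.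
    refine ⟨max 0 (μ - TwoLevel.Model.value ⟨β, γ, δ, r, cPlus, cMinus, μ⟩ μ / cPlus),
      ⟨le_max_left _ _, max_le hμ₀ (sub_le_self _ (div_nonneg
        ((TwoLevel.Model.regular_value h).nonneg μ) h.cPlus_pos.le))⟩,
      0, ⟨le_rfl, hμ₀⟩, fun _ σ => ?_, fun h' => absurd h' hlt.not_ge, fun h' => ?_⟩
    · rw [hiff σ]
      refine forall_congr' fun l => forall_congr' fun x => forall_congr' fun hx => ?_
      rw [TwoLevel.Model.selector_of_lt_muLow h hlt x hx]
    · exact absurd ((add_le_add_left (le_max_left _ _) _).trans h') hlt.not_ge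
  · obtain ⟨y, hy, hsel⟩ := TwoLevel.Model.exists_selector_of_muLow_le h hge
    refine ⟨μ - r / cMinus, TwoLevel.Model.breakEven_mem h hge, y, hy,
      fun h' => absurd h' hge.not_gt, fun _ _ σ => ?_, fun h' σ => ?_⟩
    · rw [hiff σ]
      refine forall_congr' fun l => forall_congr' fun x => forall_congr' fun hx => ?_
      rw [hsel x hx]
    · rw [hiff σ]
      refine forall_congr' fun l => forall_congr' fun x => forall_congr' fun hx => ?_
      rw [TwoLevel.Model.selector_of_muHigh_le h hge
        ((add_le_add_left (le_max_right _ _) _).trans h') x]
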